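/- Give the set $\{*,1,2\}$ the topology with basis $\{\{1\},\{2\},\{*,1,2\}\}$, and give sets of sequences over it the (subspace of the) product topology. Write $a\approx b$ for letters if $a=b$ or at least one of $a,b$ equals $*$, and extend $\approx$ coordinatewise to sequences; let $\sigma$ be the shift. For $\tau\in\{*,1,2\}^{\{0,1,2,\ldots\}}$ let $D_\tau$ be the set of all $x=x_0x_1x_2\ldots$ such that, for every $n\ge 0$, $x_n=*$ implies $\sigma^n x=\tau$, and $\sigma^n x\approx\tau$ implies $\sigma^n x=\tau$. Let $\hat D_\tau$ be the space of all $\hat x\in\{*,1,2\}^{\mathbb Z}$ such that $\hat x_n\hat x_{n+1}\hat x_{n+2}\ldots\in D_\tau$ for every $n\in\mathbb Z$ (a model of the inverse limit of $D_\tau$ with bonding map $\sigma$). For a left-infinite sequence $e=\ldots e_{-3}e_{-2}e_{-1}$ put $T(e)=\{\hat y\in\hat D_\tau:\hat y_i\approx e_i\text{ for all }i\le -1\}$. A ray in $\hat D_\tau$ is the image of a continuous injection $\phi:[0,\infty)\to\hat D_\tau$ (a parameterization), and it originates in $T(e)$ if $\phi(0)\in T(e)$. Two rays are asymptotic if they have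 parameterizations $\phi,\phi'$ with $d(\phi(s),\phi'(s))\to 0$ as $s\to\infty$, where $d$ is a metric compatible with the topology of $\hat D_\tau$. Theorem. Let $N$ and $l$ be natural numbers with $1\le l\le N-2$, and let $\tau=(*\,1\,2^{N-2})^\infty$ with $\tau_0=*$. Let $$e=\ldots www\,1\,2^{N-2}\,1\quad\text{and}\quad \tilde e=\ldots www\,1\,2^{N-2}\,1\,2^{l},\qquad w=1\,2^{N-3}\,1,$$ be left-infinite sequences, indexed by the negative integers. Then $\hat D_\tau$ is metrizable, and there are rays in $\hat D_\tau$, one originating in $T(e)$ and one originating in $T(\tilde e)$, that are asymptotic (for parameterizations starting in $T(e)$ and $T(\tilde e)$, and for every compatible metric $d$). -/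

import Mathlib

open scoped NNReal Topology

namespace DendriteLimit

/-- The alphabet `{*, 1, 2}`. -/
inductive Letter : Type
  | star : Letter
  | one : Letter
  | two : Letter

/-- The topology on `{*, 1, 2}` with basis `{1}`, `{2}`, `{*, 1, 2}`. -/
instance : TopologicalSpace Letter :=
  TopologicalSpace.generateFrom {{Letter.one}, {Letter.two}, Set.univ}

/-- The relation `a ≈ b` on letters: `a = b`, or at least one of `a`, `b` is `*`. -/
def Letter.Compat (a b : Letter) : Prop :=
  a = b ∨ a = Letter.star ∨ b = Letter.star

/-- The relation `x ≈ y` on one-sided sequences: coordinatewise `≈`. -/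
def Compat (x y : ℕ → Letter) : Prop :=
  ∀ n, (x n).Compat (y n)

/-- The `n`-fold shift `σⁿ x = x_n x_{n+1} x_{n+2} …` of a one-sided sequence. -/
def shift (n : ℕ) (x : ℕ → Letter) : ℕ → Letter :=
  fun i => x (n + i)

/-- `D_τ`, the set of `τ`-admissible sequences: whenever `x_n = *` one has `σⁿ x = τ`, and
whenever `σⁿ x ≈ τ` one has `σⁿ x = τ`. -/
def D (τ : ℕ → Letter) : Set (ℕ → Letter) :=
  {x | ∀ n, (x n = Letter.star → shift n x = τ) ∧ (Compat (shift n x) τ → shift n x = τ)}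

/-- `π_n(x̂) = x̂_n x̂_{n+1} x̂_{n+2} …` for a two-sided sequence `x̂`. -/
def proj (n : ℤ) (x : ℤ → Letter) : ℕ → Letter :=
  fun i => x (n + i)

/-- `D̂_τ`, the set of two-sided sequences all of whose projections `π_n` lie in `D_τ`. As a type
it carries the subspace topology of the product topology on `{*, 1, 2}^ℤ`. -/
def DHat (τ : ℕ → Letter) : Set (ℤ → Letter) :=
  {x | ∀ n : ℤ, proj n x ∈ D τ}

/-- The set `T(e)` of all points of `D̂_τ` whose negative coordinates are `≈` those of the
left-infinite sequence `e = … e_{-3} e_{-2} e_{-1}`. A left-infinite sequence is read from right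
to left: `e k` stands for `e_{-(k+1)}`. -/
def T (τ : ℕ → Letter) (e : ℕ → Letter) : Set (DHat τ) :=
  {y | ∀ k : ℕ, (y.1 (-((k : ℤ) + 1))).Compat (e k)}

/-- The right-infinite periodic sequence `w w w …`. -/
def rightPeriodic (w : List Letter) : ℕ → Letter :=
  fun n => w.getD (n % w.length) Letter.star

/-- The left-infinite sequence `… w w w v`, read from right to left. -/
def leftPeriodic (w v : List Letter) : ℕ → Letter :=
  fun k =>
    if k < v.length then v.reverse.getD k Letter.star
    else w.reverse.getD ((k - v.length) % w.length) Letter.star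

/-- The block `2^n`. -/
def twos (n : ℕ) : List Letter := List.replicate n Letter.two

/-- The kneading sequence `τ = (* 1 2^{N-2})^∞`. -/
def kneading (N : ℕ) : ℕ → Letter :=
  rightPeriodic ([Letter.star, Letter.one] ++ twos (N - 2))

/-- The left-infinite sequence `e = (1 2^{N-3} 1)^∞ 1 2^{N-2} 1`. -/
def eSeq (N : ℕ) : ℕ → Letter :=
  leftPeriodic ([Letter.one] ++ twos (N - 3) ++ [Letter.one])
    ([Letter.one] ++ twos (N - 2) ++ [Letter.one])

/-- The left-infinite sequence `ẽ = (1 2^{N-3} 1)^∞ 1 2^{N-2} 1 2^l`. -/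
def eTildeSeq (N l : ℕ) : ℕ → Letter :=
  leftPeriodic ([Letter.one] ++ twos (N - 3) ++ [Letter.one])
    ([Letter.one] ++ twos (N - 2) ++ [Letter.one] ++ twos l)

/-- `φ` parameterizes a ray in `X`: it is a continuous bijection from `[0, ∞)` onto its image. -/
def ParametrizesRay {X : Type*} [TopologicalSpace X] (φ : ℝ≥0 → X) : Prop :=
  Continuous φ ∧ Function.Injective φ

/-- The parameterizations `φ` and `φ'` are asymptotic: `X` is metrizable, and
`d(φ(s), φ'(s)) → 0` as `s → ∞` for every metric `d` compatible with the topology of `X`. -/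
def Asymptotic {X : Type*} [tX : TopologicalSpace X] (φ φ' : ℝ≥0 → X) : Prop :=
  TopologicalSpace.MetrizableSpace X ∧
    ∀ m : MetricSpace X, m.toPseudoMetricSpace.toUniformSpace.toTopologicalSpace = tX →
      Filter.Tendsto (fun s => m.dist (φ s) (φ' s)) Filter.atTop (𝓝 0)

end DendriteLimit

/-!
The rays are found inside the inverse limit of a tent map. Put `M = N - 1` and let `λ` be the root
of `λ^M (2 - λ) = 1` near `2`. For the tent map `x ↦ 1 - λ|x|` the critical point `0` is periodic
of period `N` with itinerary `(* 1 2^{N-2})^∞ = τ` (`IsTentSlope.side_iterate_zero`). Because the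
map expands by `λ`, sending a two-sided orbit in `[-1, 1]` to its itinerary is a continuous
injection of the inverse limit into `D̂_τ` (`continuous_coding`, `injective_coding`).

The tent map has a periodic orbit of period dividing `M` with itinerary `(1 2^{M-2} 1)^∞`. Moving
away from it in the inverse limit, with speed `±λ^k` at level `k`, gives unfolded paths whose
coordinates `H_j(u)`, with the phase `j` taken modulo `M`, satisfy `H_{j+1}(λ u) = tent (H_j(u))`
(`rayCoord`). Write `d = (2 - λ)/(λ - 1)` for the distance from the critical value to this orbit.
Each phase reaches a point of the critical orbit, and then rises to the critical value `1`; for all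
phases this happens at the same arc length `d + 2 = λ (d + 1)`, and on `[d + 1, λ (d + 1)]` all
phases are equal to `u - (d + 1)` (`IsTentSlope.rayCoord_rise`). By the functional equation they
agree for all `u ≥ d + 1` (`IsTentSlope.rayCoord_eq_rayCoord`). Hence two rays of different phases
agree at each level `k` from some arc length on, which makes them asymptotic since the inverse
limit is compact (`asymptotic_coding`). The letters of the rays of phases `1` and `1 + l` at arc
length `d + 2` are computed in `IsTentSlope.side_rayCoord_compat`.

Metrizability of `D̂_τ` is Urysohn's theorem: the topology is second countable and `T₀`, and it is
regular because a letter `x_k ≠ *` is forced by conditions up to `≈` on two coordinates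
(`regularSpace_DHat`).
-/

namespace DendriteLimit

open Filter Function

/-! ### Metrizability of `D̂_τ` -/

theorem isOpen_singleton_one : IsOpen ({Letter.one} : Set Letter) :=
  TopologicalSpace.isOpen_generateFrom_of_mem (by simp)

theorem isOpen_singleton_two : IsOpen ({Letter.two} : Set Letter) :=
  TopologicalSpace.isOpen_generateFrom_of_mem (by simp)

instance : SecondCountableTopology Letter :=
  ⟨⟨{{Letter.one}, {Letter.two}, Set.univ}, Set.to_countable _, rfl⟩⟩

theorem mem_nhds_star {s : Set Letter} (hs : s ∈ 𝓝 Letter.star) : s = Set.univ := by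
  have h : 𝓝 Letter.star = ⊤ := by
    rw [TopologicalSpace.nhds_generateFrom]
    simp only [Set.mem_ofPred_eq, iInf_eq_top, and_imp]
    rintro t ht (rfl | rfl | rfl)
    · simp at ht
    · simp at ht
    · simp
  rwa [h, mem_top] at hs

theorem Letter.isOpen_singleton {a : Letter} (ha : a ≠ Letter.star) :
    IsOpen ({a} : Set Letter) := by
  cases a
  · exact absurd rfl ha
  · exact isOpen_singleton_one
  · exact isOpen_singleton_two

theorem Letter.isClosed_compat (a : Letter) : IsClosed {b : Letter | b.Compat a} := by
  cases a
  · convert isClosed_univ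
    simp [Letter.Compat]
  · rw [← isOpen_compl_iff]
    convert isOpen_singleton_two
    ext b; cases b <;> simp [Letter.Compat]
  · rw [← isOpen_compl_iff]
    convert isOpen_singleton_one
    ext b; cases b <;> simp [Letter.Compat]

theorem continuous_coord {τ : ℕ → Letter} (k : ℤ) : Continuous fun y : DHat τ => y.1 k :=
  (continuous_apply k).comp continuous_subtype_val

instance {τ : ℕ → Letter} : T0Space (DHat τ) := by
  refine ⟨fun x y h => Subtype.ext (funext fun k => ?_)⟩
  have h1 := (h.map (continuous_coord k)).mem_open_iff isOpen_singleton_one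
  have h2 := (h.map (continuous_coord k)).mem_open_iff isOpen_singleton_two
  simp only [Set.mem_singleton_iff] at h1 h2
  cases hx : x.1 k <;> cases hy : y.1 k <;> simp_all

/-- If `x_k ≠ *` then `σᵏ x ≉ τ`, so some coordinate `n` witnesses this; prescribing the
coordinates `k` and `k + n` up to `≈` is a closed condition that already forces `y_k = x_k`. -/
theorem regularSpace_DHat {τ : ℕ → Letter} (hτ : τ 0 = Letter.star) : RegularSpace (DHat τ) := by
  refine RegularSpace.of_lift'_closure_le fun x => ?_
  conv_rhs => rw [nhds_subtype, nhds_pi, Filter.pi, comap_iInf]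
  refine le_iInf fun k => ?_
  rw [comap_comap]
  intro s hs
  obtain ⟨t, ht, hts⟩ := hs
  by_cases hk : x.1 k = Letter.star
  · rw [hk] at ht
    have : s = Set.univ := by
      rw [mem_nhds_star ht] at hts
      simpa using hts
    rw [this]
    exact univ_mem
  · have hne : ¬ Compat (shift 0 (proj k x.1)) τ := fun hc => by
      have := congrFun ((x.2 k 0).2 hc) 0
      simp only [shift, proj] at this
      rw [hτ] at this
      exact hk (by simpa using this)
    obtain ⟨n, hn⟩ : ∃ n : ℕ, ¬ (x.1 (k + n)).Compat (τ n) := by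
      simpa [Compat, shift, proj] using hne
    have hxn : x.1 (k + n) ≠ Letter.star := fun h => hn (Or.inr (Or.inl h))
    have hU : {y : DHat τ | y.1 k = x.1 k} ∩ {y : DHat τ | y.1 (k + n) = x.1 (k + n)} ∈ 𝓝 x :=
      inter_mem
        (((Letter.isOpen_singleton hk).preimage (continuous_coord k)).mem_nhds rfl)
        (((Letter.isOpen_singleton hxn).preimage (continuous_coord (k + n))).mem_nhds rfl)
    refine mem_of_superset (mem_lift' hU) (Set.Subset.trans ?_ hts)
    have hV : IsClosed ({y : DHat τ | (y.1 k).Compat (x.1 k)} ∩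
        {y : DHat τ | (y.1 (k + n)).Compat (x.1 (k + n))}) :=
      ((Letter.isClosed_compat _).preimage (continuous_coord k)).inter
        ((Letter.isClosed_compat _).preimage (continuous_coord (k + n)))
    have hsub : {y : DHat τ | y.1 k = x.1 k} ∩ {y : DHat τ | y.1 (k + n) = x.1 (k + n)} ⊆
        {y : DHat τ | (y.1 k).Compat (x.1 k)} ∩
          {y : DHat τ | (y.1 (k + n)).Compat (x.1 (k + n))} :=
      Set.inter_subset_inter (fun y hy => Or.inl hy) (fun y hy => Or.inl hy)
    have hUV := closure_minimal hsub hV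
    intro y hy
    obtain ⟨h1, h2⟩ := hUV hy
    have hyk : y.1 k = x.1 k := by
      rcases h1 with h1 | h1 | h1
      · exact h1
      · have h3 := congrFun ((y.2 k 0).1 (by simpa [proj] using h1)) n
        simp only [shift, proj, zero_add] at h3
        rw [Set.mem_ofPred_eq, h3] at h2
        rcases h2 with h2 | h2 | h2
        · exact absurd (Or.inl h2.symm) hn
        · exact absurd (Or.inr (Or.inr h2)) hn
        · exact absurd h2 hxn
      · exact absurd h1 hk
    change y.1 k ∈ t
    rw [hyk]
    exact mem_of_mem_nhds ht

theorem metrizableSpace_DHat {τ : ℕ → Letter} (hτ : τ 0 = Letter.star) :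
    TopologicalSpace.MetrizableSpace (DHat τ) := by
  have := regularSpace_DHat hτ
  have : T3Space (DHat τ) := {}
  exact TopologicalSpace.metrizableSpace_of_t3_secondCountable _

/-! ### The tent map and its itineraries -/

/-- The tent map `x ↦ 1 - λ|x|` with critical point `0`, critical value `1` and slopes `±λ`. -/
def tent (lam x : ℝ) : ℝ := 1 - lam * |x|

/-- The side of the critical point `0` on which `x` lies: `1` on the right, `2` on the left,
`*` at the critical point itself. -/
noncomputable def side (x : ℝ) : Letter :=
  if 0 < x then Letter.one else if x < 0 then Letter.two else Letter.star

theorem side_zero : side 0 = Letter.star := by simp [side]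

theorem side_of_pos {x : ℝ} (h : 0 < x) : side x = Letter.one := by simp [side, h]

theorem side_of_neg {x : ℝ} (h : x < 0) : side x = Letter.two := by simp [side, h, h.le]

theorem eq_zero_of_side_eq_star {x : ℝ} (h : side x = Letter.star) : x = 0 := by
  rcases lt_trichotomy x 0 with hx | hx | hx
  · simp [side_of_neg hx] at h
  · exact hx
  · simp [side_of_pos hx] at h

theorem side_compat_one {x : ℝ} (h : 0 ≤ x) : (side x).Compat Letter.one := by
  rcases h.eq_or_lt with rfl | h
  · exact Or.inr (Or.inl side_zero)
  · exact Or.inl (side_of_pos h)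

theorem side_compat_two {x : ℝ} (h : x ≤ 0) : (side x).Compat Letter.two := by
  rcases h.eq_or_lt with rfl | h
  · exact Or.inr (Or.inl side_zero)
  · exact Or.inl (side_of_neg h)

/-- The only neighbourhood of `*` is everything, so a jump through `*` is continuous. -/
theorem continuous_side : Continuous side := by
  refine continuous_generateFrom_iff.2 ?_
  rintro s (rfl | rfl | rfl)
  · convert isOpen_Ioi (a := (0 : ℝ)) using 1
    ext x
    rcases lt_trichotomy x 0 with hx | rfl | hx <;>
      simp [side_of_neg, side_zero, side_of_pos, *, le_of_lt]
  · convert isOpen_Iio (a := (0 : ℝ)) using 1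
    ext x
    rcases lt_trichotomy x 0 with hx | rfl | hx <;>
      simp [side_of_neg, side_zero, side_of_pos, *, le_of_lt]
  · exact isOpen_univ

theorem tent_of_nonneg {lam x : ℝ} (h : 0 ≤ x) : tent lam x = 1 - lam * x := by
  rw [tent, abs_of_nonneg h]

theorem tent_of_nonpos {lam x : ℝ} (h : x ≤ 0) : tent lam x = 1 + lam * x := by
  rw [tent, abs_of_nonpos h]; ring

theorem continuous_tent (lam : ℝ) : Continuous (tent lam) := by
  unfold tent; fun_prop

theorem abs_tent_le_one {lam x : ℝ} (h0 : 0 ≤ lam) (h2 : lam ≤ 2) (hx : |x| ≤ 1) :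
    |tent lam x| ≤ 1 := by
  have := mul_le_mul h2 hx (abs_nonneg x) zero_le_two
  have := mul_nonneg h0 (abs_nonneg x)
  rw [tent, abs_le]
  constructor <;> linarith

theorem abs_iterate_tent_le_one {lam x : ℝ} (h0 : 0 ≤ lam) (h2 : lam ≤ 2) (hx : |x| ≤ 1) (n : ℕ) :
    |(tent lam)^[n] x| ≤ 1 := by
  induction n with
  | zero => exact hx
  | succ n ih =>
    rw [iterate_succ_apply']
    exact abs_tent_le_one h0 h2 ih

theorem abs_tent_sub_of_compat {lam x y : ℝ} (h0 : 0 ≤ lam) (h : (side x).Compat (side y)) :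
    |tent lam x - tent lam y| = lam * |x - y| := by
  have key : (0 ≤ x ∧ 0 ≤ y) ∨ (x ≤ 0 ∧ y ≤ 0) := by
    rcases lt_trichotomy x 0 with hx | rfl | hx <;> rcases lt_trichotomy y 0 with hy | rfl | hy
    all_goals first
      | exact Or.inl ⟨by linarith, by linarith⟩
      | exact Or.inr ⟨by linarith, by linarith⟩
      | (simp [side_of_neg, side_of_pos, Letter.Compat, hx, hy] at h)
  rcases key with ⟨hx, hy⟩ | ⟨hx, hy⟩
  · rw [tent_of_nonneg hx, tent_of_nonneg hy, abs_sub_comm x y]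
    rw [show 1 - lam * x - (1 - lam * y) = lam * (y - x) by ring, abs_mul, abs_of_nonneg h0]
  · rw [tent_of_nonpos hx, tent_of_nonpos hy]
    rw [show 1 + lam * x - (1 + lam * y) = lam * (x - y) by ring, abs_mul, abs_of_nonneg h0]

/-- Expansivity: as long as two orbits stay weakly on the same side of `0`, their distance grows
by the factor `λ > 1` at each step. -/
theorem eq_of_itinerary_compat {lam x y : ℝ} (h1 : 1 < lam) (h2 : lam ≤ 2) (hx : |x| ≤ 1)
    (hy : |y| ≤ 1)
    (h : ∀ n, (side ((tent lam)^[n] x)).Compat (side ((tent lam)^[n] y))) : x = y := by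
  have h0 : 0 ≤ lam := by linarith
  have hexp : ∀ n, |(tent lam)^[n] x - (tent lam)^[n] y| = lam ^ n * |x - y| := by
    intro n
    induction n with
    | zero => simp
    | succ n ih =>
      rw [iterate_succ_apply', iterate_succ_apply', abs_tent_sub_of_compat h0 (h n), ih]
      ring
  by_contra hne
  have hpos : 0 < |x - y| := abs_pos.2 (sub_ne_zero.2 hne)
  obtain ⟨n, hn⟩ := pow_unbounded_of_one_lt (2 / |x - y|) h1
  rw [div_lt_iff₀ hpos, ← hexp] at hn
  have hxn := abs_iterate_tent_le_one h0 h2 hx n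
  have hyn := abs_iterate_tent_le_one h0 h2 hy n
  have := abs_sub ((tent lam)^[n] x) ((tent lam)^[n] y)
  linarith

/-- The inverse limit of the tent map on `[-1, 1]`, as the space of its two-sided orbits. -/
def Orbits (lam : ℝ) : Set (ℤ → ℝ) :=
  {x | (∀ k, x k ∈ Set.Icc (-1 : ℝ) 1) ∧ ∀ k, x (k + 1) = tent lam (x k)}

instance (lam : ℝ) : CompactSpace (Orbits lam) := by
  rw [← isCompact_iff_compactSpace]
  have hc : IsCompact (Set.pi Set.univ fun _ : ℤ => Set.Icc (-1 : ℝ) 1) :=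
    isCompact_univ_pi fun _ => isCompact_Icc
  refine hc.of_isClosed_subset ?_ fun x hx k _ => hx.1 k
  have h1 : IsClosed {x : ℤ → ℝ | ∀ k, x k ∈ Set.Icc (-1 : ℝ) 1} := by
    rw [Set.ofPred_forall]
    exact isClosed_iInter fun k => isClosed_Icc.preimage (continuous_apply k)
  have h2 : IsClosed {x : ℤ → ℝ | ∀ k, x (k + 1) = tent lam (x k)} := by
    rw [Set.ofPred_forall]
    exact isClosed_iInter fun k =>
      isClosed_eq (continuous_apply _) ((continuous_tent lam).comp (continuous_apply k))
  exact h1.inter h2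

theorem Orbits.iterate {lam : ℝ} {x : ℤ → ℝ} (hx : x ∈ Orbits lam) (k : ℤ) (n : ℕ) :
    x (k + n) = (tent lam)^[n] (x k) := by
  induction n with
  | zero => simp
  | succ n ih => rw [iterate_succ_apply', ← ih, ← hx.2]; push_cast; ring_nf

theorem itinerary_mem_DHat {lam : ℝ} {τ : ℕ → Letter} (h1 : 1 < lam) (h2 : lam ≤ 2)
    (hτ : ∀ n, side ((tent lam)^[n] 0) = τ n) {x : ℤ → ℝ} (hx : x ∈ Orbits lam) :
    (fun k => side (x k)) ∈ DHat τ := by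
  have key : ∀ (k : ℤ) (n : ℕ), x (k + n) = 0 →
      shift n (proj k fun k => side (x k)) = τ := by
    intro k n h0
    funext i
    simp only [shift, proj]
    rw [show k + ((n + i : ℕ) : ℤ) = k + n + i by push_cast; ring, Orbits.iterate hx, h0, hτ]
  intro k n
  refine ⟨fun h => key k n (eq_zero_of_side_eq_star h), fun h => key k n ?_⟩
  refine eq_of_itinerary_compat h1 h2 (abs_le.2 (hx.1 _)) (by simp) fun i => ?_
  rw [hτ, ← Orbits.iterate hx]
  have := h i
  simp only [shift, proj] at this
  rwa [show k + ((n + i : ℕ) : ℤ) = k + n + i by push_cast; ring] at this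

/-- The coding map, sending a two-sided orbit to its itinerary. -/
noncomputable def coding {lam : ℝ} {τ : ℕ → Letter} (h1 : 1 < lam) (h2 : lam ≤ 2)
    (hτ : ∀ n, side ((tent lam)^[n] 0) = τ n) (x : Orbits lam) : DHat τ :=
  ⟨fun k => side (x.1 k), itinerary_mem_DHat h1 h2 hτ x.2⟩

theorem continuous_coding {lam : ℝ} {τ : ℕ → Letter} (h1 : 1 < lam) (h2 : lam ≤ 2)
    (hτ : ∀ n, side ((tent lam)^[n] 0) = τ n) : Continuous (coding h1 h2 hτ) :=
  Continuous.subtype_mk (continuous_pi fun k =>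
    continuous_side.comp ((continuous_apply k).comp continuous_subtype_val)) _

theorem injective_coding {lam : ℝ} {τ : ℕ → Letter} (h1 : 1 < lam) (h2 : lam ≤ 2)
    (hτ : ∀ n, side ((tent lam)^[n] 0) = τ n) : Injective (coding h1 h2 hτ) := by
  intro x y h
  refine Subtype.ext (funext fun k => ?_)
  refine eq_of_itinerary_compat h1 h2 (abs_le.2 (x.2.1 k)) (abs_le.2 (y.2.1 k)) fun n => ?_
  rw [← Orbits.iterate x.2, ← Orbits.iterate y.2]
  exact Or.inl (congrFun (congrArg Subtype.val h) (k + n))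

/-- Compactness of the inverse limit makes the coding map uniformly continuous for every
compatible metric, so agreement of each coordinate from some time on is enough. -/
theorem asymptotic_coding {lam : ℝ} {τ : ℕ → Letter} (h1 : 1 < lam) (h2 : lam ≤ 2)
    (hτ : ∀ n, side ((tent lam)^[n] 0) = τ n) (ψ ψ' : ℝ≥0 → Orbits lam)
    (h : ∀ k, ∀ᶠ s in atTop, (ψ s).1 k = (ψ' s).1 k) :
    Asymptotic (fun s => coding h1 h2 hτ (ψ s)) (fun s => coding h1 h2 hτ (ψ' s)) := by
  refine ⟨metrizableSpace_DHat (by rw [← hτ 0]; exact side_zero), fun m hm => ?_⟩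
  have hcont := continuous_coding h1 h2 hτ
  rw [← hm] at hcont
  have huc := @CompactSpace.uniformContinuous_of_continuous _ _ _
    m.toPseudoMetricSpace.toUniformSpace _ _ hcont
  have hψ : Tendsto (fun s => (ψ s, ψ' s)) atTop (uniformity (Orbits lam)) := by
    rw [uniformity_subtype, tendsto_comap_iff, Pi.uniformity, tendsto_iInf]
    intro k
    rw [tendsto_comap_iff]
    refine tendsto_iff_forall_eventually_mem.2 fun s hs => ?_
    filter_upwards [h k] with t ht
    simp only [comp_apply, ht]
    exact refl_mem_uniformity hs
  have hd := Tendsto.comp huc hψ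
  let _ := m
  exact tendsto_uniformity_iff_dist_tendsto_zero.1 hd

/-! ### The slope for which the critical point is periodic -/

/-- `λ^M (2 - λ) = 1`, which says that the critical orbit of the tent map closes up after `M + 1`
steps with all points between the critical value and the critical point on the left. The bound
`3/2 ≤ λ` excludes the root `λ = 1` of the equation and gives `d ≤ 1` for `d = gap λ`. -/
structure IsTentSlope (M : ℕ) (lam : ℝ) : Prop where
  two_le : 2 ≤ M
  le_lam : 3 / 2 ≤ lam
  lt_two : lam < 2
  pow_mul_two_sub : lam ^ M * (2 - lam) = 1

theorem exists_isTentSlope {M : ℕ} (hM : 2 ≤ M) : ∃ lam, IsTentSlope M lam := by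
  have hc : ContinuousOn (fun x : ℝ => x ^ M * (2 - x)) (Set.Icc (3 / 2) 2) := by fun_prop
  have hmem : (1 : ℝ) ∈ Set.Icc ((2 : ℝ) ^ M * (2 - 2)) ((3 / 2) ^ M * (2 - 3 / 2)) := by
    have : (3 / 2 : ℝ) ^ 2 ≤ (3 / 2) ^ M := pow_le_pow_right₀ (by norm_num) hM
    norm_num at this ⊢
    linarith
  obtain ⟨x, ⟨hx1, hx2⟩, hx⟩ := intermediate_value_Icc' (by norm_num) hc hmem
  refine ⟨x, hM, hx1, lt_of_le_of_ne hx2 ?_, hx⟩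
  rintro rfl
  norm_num at hx

/-- The distance `d = (2 - λ)/(λ - 1)` from the critical value `1` to the nearest point of the
periodic orbit with itinerary `(1 2^{M-2} 1)^∞`. -/
noncomputable def gap (lam : ℝ) : ℝ := (2 - lam) / (lam - 1)

namespace IsTentSlope

variable {M : ℕ} {lam : ℝ}

theorem one_lt (h : IsTentSlope M lam) : 1 < lam := by linarith [h.le_lam]

theorem pos (h : IsTentSlope M lam) : 0 < lam := by linarith [h.le_lam]

theorem gap_pos (h : IsTentSlope M lam) : 0 < gap lam :=
  div_pos (by linarith [h.lt_two]) (by linarith [h.one_lt])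

theorem gap_le_one (h : IsTentSlope M lam) : gap lam ≤ 1 := by
  rw [gap, div_le_one (by linarith [h.one_lt])]
  linarith [h.le_lam]

theorem mul_gap (h : IsTentSlope M lam) : lam * (gap lam + 1) = gap lam + 2 := by
  have : lam - 1 ≠ 0 := by linarith [h.one_lt]
  rw [gap]; field_simp; ring

theorem pow_mul_gap (h : IsTentSlope M lam) : lam ^ M * gap lam = gap lam + 1 := by
  have h1 : lam - 1 ≠ 0 := by linarith [h.one_lt]
  have := h.pow_mul_two_sub
  rw [gap]; field_simp; linarith

theorem pow_le_pow (h : IsTentSlope M lam) {m n : ℕ} (hmn : m ≤ n) :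
    lam ^ m * gap lam ≤ lam ^ n * gap lam :=
  mul_le_mul_of_nonneg_right (pow_le_pow_right₀ h.one_lt.le hmn) h.gap_pos.le

theorem two_mul_pow_le (h : IsTentSlope M lam) {j : ℕ} (hj : j + 2 ≤ M) :
    2 * (lam ^ j * gap lam) ≤ gap lam + 1 := by
  rw [← h.pow_mul_gap]
  have h1 := h.pow_le_pow hj
  have h2 : 2 ≤ lam ^ 2 := by nlinarith [h.le_lam]
  have h3 : 0 ≤ lam ^ j * gap lam := mul_nonneg (pow_nonneg h.pos.le _) h.gap_pos.le
  rw [pow_add] at h1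
  nlinarith

/-- The critical orbit. -/
theorem iterate_critical (h : IsTentSlope M lam) {j : ℕ} (hj : j < M) :
    (tent lam)^[j + 2] 0 = lam ^ (j + 1) * gap lam - (gap lam + 1) := by
  induction j with
  | zero =>
    have := h.mul_gap
    simp only [iterate_succ_apply', iterate_zero, id]
    rw [tent_of_nonneg le_rfl, tent_of_nonneg (by simp)]
    simp only [zero_add, pow_one]; linarith
  | succ j ih =>
    rw [show j + 1 + 2 = (j + 2) + 1 by ring, iterate_succ_apply', ih (by omega)]
    have h1 := h.pow_le_pow (show j + 1 ≤ M by omega)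
    rw [h.pow_mul_gap] at h1
    rw [tent_of_nonpos (by linarith), pow_succ lam (j + 1)]
    linarith [h.mul_gap]

/-- The itinerary of the critical point is the kneading sequence. -/
theorem side_iterate_zero (h : IsTentSlope M lam) (n : ℕ) :
    side ((tent lam)^[n] 0) = kneading (M + 1) n := by
  have hM := h.two_le
  have hlen : ([Letter.star, Letter.one] ++ twos (M + 1 - 2)).length = M + 1 := by
    simp [twos]; omega
  have hper : IsPeriodicPt (tent lam) (M + 1) 0 := by
    have := h.iterate_critical (j := M - 1) (by omega)
    rw [show M - 1 + 2 = M + 1 by omega, show M - 1 + 1 = M by omega, h.pow_mul_gap] at this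
    rw [IsPeriodicPt, IsFixedPt, this]; ring
  rw [kneading, rightPeriodic, hlen, ← hper.iterate_mod_apply n]
  have hlt := Nat.mod_lt n (Nat.succ_pos M)
  generalize n % (M + 1) = r at hlt ⊢
  rcases r with _ | _ | r
  · simp [side_zero]
  · simp [tent, side_of_pos]
  · have hr : r < M - 1 := by omega
    have h1 : lam ^ (r + 1) * gap lam < lam ^ M * gap lam :=
      mul_lt_mul_of_pos_right (pow_lt_pow_right₀ h.one_lt (by omega)) h.gap_pos
    rw [h.pow_mul_gap] at h1
    rw [h.iterate_critical (by omega), side_of_neg (by linarith)]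
    simp [twos, List.getD_eq_getElem?_getD, hr]

end IsTentSlope

/-! ### The unfolded rays -/

/-- The coordinate `H_j(u)` of a ray at a level of phase `j` modulo `M`, at arc length `u` from the
periodic point. Phase `0` starts at `1 - d`, moving up with unit speed, and the other phases are
determined by `H_{j+1}(λ u) = tent (H_j(u))`. Explicitly `H_j(u)` is the `n`-th image of
`1 - d + u/λⁿ` for any `n ≡ j` modulo `M` with `u ≤ λⁿ d`, see `IsTentSlope.rayCoord_eq`; the
definition picks one such `n`. -/
noncomputable def rayCoord (M : ℕ) (lam : ℝ) (j : ℤ) (u : ℝ) : ℝ :=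
  (tent lam)^[M * ⌈u⌉₊ + (j % M).toNat]
    (1 - gap lam + u / lam ^ (M * ⌈u⌉₊ + (j % M).toNat))

theorem rayCoord_congr {M : ℕ} {lam : ℝ} {i j : ℤ} (hij : i ≡ j [ZMOD M]) (u : ℝ) :
    rayCoord M lam i u = rayCoord M lam j u := by
  rw [rayCoord, rayCoord, hij.eq]

namespace IsTentSlope

variable {M : ℕ} {lam : ℝ}

theorem iterate_near (h : IsTentSlope M lam) {v : ℝ} (hv : 0 ≤ v) {j : ℕ} (h1 : 1 ≤ j)
    (hj : j < M) :
    (tent lam)^[j] (1 - gap lam + v) = lam ^ j * (2 * gap lam - v) - (gap lam + 1) := by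
  induction j, h1 using Nat.le_induction with
  | base =>
    rw [iterate_one, tent_of_nonneg (by linarith [h.gap_le_one])]
    linarith [h.mul_gap]
  | succ j hj1 ih =>
    have h2 := h.two_mul_pow_le (show j + 2 ≤ M by omega)
    have h3 : 0 ≤ lam ^ j * v := mul_nonneg (pow_nonneg h.pos.le _) hv
    rw [iterate_succ_apply', ih (by omega), tent_of_nonpos (by linarith), pow_succ]
    linarith [h.mul_gap]

/-- The `(M - 1)`-st image of `1 - d + v` is where the orbit meets the critical point: it changes
sign at `λ^M v = d`. -/
theorem iterate_pred (h : IsTentSlope M lam) {v : ℝ} (hv : 0 ≤ v) :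
    lam * (tent lam)^[M - 1] (1 - gap lam + v) = gap lam - lam ^ M * v := by
  have hM := h.two_le
  rw [h.iterate_near hv (by omega) (by omega)]
  have h1 : lam ^ M = lam * lam ^ (M - 1) := by
    rw [← pow_succ']; congr 1; omega
  have h2 := h.pow_mul_gap
  rw [h1] at h2 ⊢
  linarith [h.mul_gap]

/-- Near `1 - d` the `M`-th iterate is affine with slope `λ^M` and fixes `1 - d`. -/
theorem iterate_period (h : IsTentSlope M lam) {v : ℝ} (hv : 0 ≤ v) (hv2 : lam ^ M * v ≤ gap lam) :
    (tent lam)^[M] (1 - gap lam + v) = 1 - gap lam + lam ^ M * v := by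
  have h1 := h.iterate_pred hv
  have h2 : 0 ≤ (tent lam)^[M - 1] (1 - gap lam + v) :=
    nonneg_of_mul_nonneg_right (by rw [h1]; linarith) h.pos
  have hM : M = (M - 1) + 1 := by have := h.two_le; omega
  conv_lhs => rw [hM, iterate_succ_apply']
  rw [tent_of_nonneg h2, h1]; ring

/-- Past the first turn of the `M`-th iterate. -/
theorem iterate_period_turn (h : IsTentSlope M lam) {v : ℝ} (hv : 0 ≤ v)
    (hv2 : gap lam ≤ lam ^ M * v) :
    (tent lam)^[M] (1 - gap lam + v) = 1 + gap lam - lam ^ M * v := by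
  have h1 := h.iterate_pred hv
  have h2 : (tent lam)^[M - 1] (1 - gap lam + v) ≤ 0 := by
    by_contra! hlt
    have := mul_pos h.pos hlt
    linarith
  have hM : M = (M - 1) + 1 := by have := h.two_le; omega
  conv_lhs => rw [hM, iterate_succ_apply']
  rw [tent_of_nonpos h2, h1]; ring

theorem iterate_add_mul (h : IsTentSlope M lam) {u : ℝ} (hu : 0 ≤ u) {n : ℕ}
    (hun : u ≤ lam ^ n * gap lam) (k : ℕ) :
    (tent lam)^[n + M * k] (1 - gap lam + u / lam ^ (n + M * k)) =
      (tent lam)^[n] (1 - gap lam + u / lam ^ n) := by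
  induction k with
  | zero => simp
  | succ k ih =>
    rw [← ih, show n + M * (k + 1) = n + M * k + M by ring, iterate_add_apply]
    have hp := pow_pos h.pos (n + M * k)
    have hp2 := pow_pos h.pos M
    have hv : lam ^ M * (u / lam ^ (n + M * k + M)) = u / lam ^ (n + M * k) := by
      rw [pow_add]; field_simp
    rw [h.iterate_period (div_nonneg hu (pow_nonneg h.pos.le _)), hv]
    rw [hv, div_le_iff₀ hp, mul_comm]
    exact hun.trans (h.pow_le_pow (by omega))

theorem le_pow_mul_gap (h : IsTentSlope M lam) {u : ℝ} (r : ℕ) :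
    u ≤ lam ^ (M * ⌈u⌉₊ + r) * gap lam := by
  refine le_trans ?_ (h.pow_le_pow (Nat.le_add_right _ r))
  have hd := h.gap_pos
  have h1 : lam ^ M = 1 + 1 / gap lam := by
    have := h.pow_mul_gap
    field_simp
    linarith
  rw [pow_mul, h1]
  have h2 := one_add_mul_le_pow (a := 1 / gap lam) (by have := one_div_pos.2 hd; linarith) ⌈u⌉₊
  have h3 := mul_le_mul_of_nonneg_right h2 hd.le
  have h4 : (1 + (⌈u⌉₊ : ℝ) * (1 / gap lam)) * gap lam = gap lam + ⌈u⌉₊ := by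
    field_simp
  linarith [Nat.le_ceil u]

theorem toNat_emod_modEq (h : IsTentSlope M lam) (k : ℕ) (j : ℤ) :
    ((M * k + (j % M).toNat : ℕ) : ℤ) ≡ j [ZMOD M] := by
  have hM : (M : ℤ) ≠ 0 := by have := h.two_le; omega
  have h0 := Int.emod_nonneg j hM
  rw [Int.modEq_iff_dvd]
  push_cast
  rw [Int.toNat_of_nonneg h0]
  refine ⟨j / M - k, ?_⟩
  have := Int.mul_ediv_add_emod j M
  linarith

theorem exists_modEq_le (h : IsTentSlope M lam) (j : ℤ) (u : ℝ) :
    ∃ n : ℕ, (n : ℤ) ≡ j [ZMOD M] ∧ u ≤ lam ^ n * gap lam :=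
  ⟨_, h.toNat_emod_modEq ⌈u⌉₊ j, h.le_pow_mul_gap _⟩

theorem rayCoord_eq (h : IsTentSlope M lam) {j : ℤ} {u : ℝ} (hu : 0 ≤ u) {n : ℕ}
    (hn : (n : ℤ) ≡ j [ZMOD M]) (hun : u ≤ lam ^ n * gap lam) :
    rayCoord M lam j u = (tent lam)^[n] (1 - gap lam + u / lam ^ n) := by
  rw [rayCoord]
  set m := M * ⌈u⌉₊ + (j % M).toNat with hm
  have hmj : (m : ℤ) ≡ j [ZMOD M] := h.toNat_emod_modEq _ _
  have hum : u ≤ lam ^ m * gap lam := h.le_pow_mul_gap _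
  clear_value m
  have hmn : (m : ℤ) ≡ n [ZMOD M] := hmj.trans hn.symm
  rw [Int.natCast_modEq_iff] at hmn
  rcases le_total m n with hle | hle
  · obtain ⟨k, hk⟩ := (Nat.modEq_iff_dvd' hle).1 hmn
    obtain rfl : n = m + M * k := by omega
    exact (h.iterate_add_mul hu hum k).symm
  · obtain ⟨k, hk⟩ := (Nat.modEq_iff_dvd' hle).1 hmn.symm
    obtain rfl : m = n + M * k := by omega
    exact h.iterate_add_mul hu hun k

theorem rayCoord_mul (h : IsTentSlope M lam) (j : ℤ) {u : ℝ} (hu : 0 ≤ u) :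
    rayCoord M lam (j + 1) (lam * u) = tent lam (rayCoord M lam j u) := by
  obtain ⟨n, hn, hun⟩ := h.exists_modEq_le j u
  have hl := h.pos
  have hp := pow_pos hl n
  rw [h.rayCoord_eq hu hn hun, h.rayCoord_eq (n := n + 1) (mul_nonneg hl.le hu)
    (by push_cast; exact hn.add_right 1), iterate_succ_apply', pow_succ', mul_div_mul_left _ _ hl.ne']
  rw [pow_succ', mul_assoc]
  exact mul_le_mul_of_nonneg_left hun hl.le

theorem abs_rayCoord_le_one (h : IsTentSlope M lam) (j : ℤ) {u : ℝ} (hu : 0 ≤ u) :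
    |rayCoord M lam j u| ≤ 1 := by
  obtain ⟨n, hn, hun⟩ := h.exists_modEq_le j u
  have hp := pow_pos h.pos n
  rw [h.rayCoord_eq hu hn hun]
  refine abs_iterate_tent_le_one h.pos.le h.lt_two.le ?_ n
  have h1 : u / lam ^ n ≤ gap lam := by rwa [div_le_iff₀ hp, mul_comm]
  have h2 : 0 ≤ u / lam ^ n := div_nonneg hu hp.le
  rw [abs_le]
  constructor <;> linarith [h.gap_le_one]

theorem continuousOn_rayCoord (h : IsTentSlope M lam) (j : ℤ) :
    ContinuousOn (rayCoord M lam j) (Set.Ici 0) := by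
  intro u hu
  obtain ⟨n, hn, hun⟩ := h.exists_modEq_le j (u + 1)
  have hc : Continuous fun u => (tent lam)^[n] (1 - gap lam + u / lam ^ n) :=
    ((continuous_tent lam).iterate n).comp (by fun_prop)
  refine hc.continuousWithinAt.congr_of_eventuallyEq ?_ (h.rayCoord_eq hu hn (by linarith))
  have h1 : Set.Iio (u + 1) ∈ 𝓝 u := Iio_mem_nhds (by linarith)
  filter_upwards [mem_nhdsWithin_of_mem_nhds h1, self_mem_nhdsWithin] with v hv hv0
  exact h.rayCoord_eq hv0 hn (by linarith [Set.mem_Iio.1 hv])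

theorem rayCoord_zero_initial (h : IsTentSlope M lam) {u : ℝ} (hu : 0 ≤ u) (hud : u ≤ gap lam) :
    rayCoord M lam 0 u = 1 - gap lam + u := by
  rw [h.rayCoord_eq (n := 0) hu (by simp) (by simpa using hud)]
  simp

theorem rayCoord_zero_turn (h : IsTentSlope M lam) {u : ℝ} (hud : gap lam ≤ u)
    (hu1 : u ≤ gap lam + 1) : rayCoord M lam 0 u = 1 + gap lam - u := by
  have hu : 0 ≤ u := h.gap_pos.le.trans hud
  have hp := pow_pos h.pos M
  have hv : lam ^ M * (u / lam ^ M) = u := by field_simp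
  rw [h.rayCoord_eq (n := M) hu (by simp [Int.ModEq]) (by rwa [h.pow_mul_gap]),
    h.iterate_period_turn (div_nonneg hu hp.le) (by rwa [hv]), hv]

theorem rayCoord_initial (h : IsTentSlope M lam) {j : ℕ} (hj1 : 1 ≤ j) (hj : j < M) {u : ℝ}
    (hu : 0 ≤ u) (huj : u ≤ lam ^ j * gap lam) :
    rayCoord M lam j u = 2 * (lam ^ j * gap lam) - u - (gap lam + 1) := by
  have hp := pow_pos h.pos j
  rw [h.rayCoord_eq hu rfl huj, h.iterate_near (div_nonneg hu hp.le) hj1 hj]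
  field_simp

/-- Phase `j`, taken with `1 ≤ j ≤ M`, turns at a point of the critical orbit at arc length `λʲ d`,
and from there it rises to the critical value `1`, which all phases attain at the same arc length
`d + 2`. -/
theorem rayCoord_rise (h : IsTentSlope M lam) {j : ℕ} (hj1 : 1 ≤ j) (hj : j ≤ M) {u : ℝ}
    (huj : lam ^ j * gap lam ≤ u) (hu : u ≤ gap lam + 2) :
    rayCoord M lam j u = u - (gap lam + 1) := by
  have hl := h.pos
  induction j, hj1 using Nat.le_induction generalizing u with
  | base =>
    obtain ⟨v, rfl⟩ : ∃ v, u = lam * v := ⟨u / lam, by field_simp⟩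
    rw [pow_one] at huj
    have hv1 := le_of_mul_le_mul_left huj hl
    rw [← h.mul_gap] at hu
    have hv2 := le_of_mul_le_mul_left hu hl
    have := h.rayCoord_mul 0 (u := v) (h.gap_pos.le.trans hv1)
    rw [zero_add] at this
    rw [Nat.cast_one, this, h.rayCoord_zero_turn hv1 hv2, tent_of_nonneg (by linarith)]
    linarith [h.mul_gap]
  | succ j hj1 ih =>
    obtain ⟨v, rfl⟩ : ∃ v, u = lam * v := ⟨u / lam, by field_simp⟩
    rw [pow_succ', mul_assoc] at huj
    have hv1 := le_of_mul_le_mul_left huj hl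
    rw [← h.mul_gap] at hu
    have hv2 := le_of_mul_le_mul_left hu hl
    have hv0 : 0 ≤ v := (mul_nonneg (pow_nonneg hl.le _) h.gap_pos.le).trans hv1
    rw [Nat.cast_succ, h.rayCoord_mul j hv0, ih (by omega) hv1 (by linarith),
      tent_of_nonpos (by linarith)]
    linarith [h.mul_gap]

/-- All phases agree from arc length `d + 1` on: they agree on `[d + 1, λ (d + 1)]` by
`rayCoord_rise`, and this is a fundamental domain for multiplication by `λ`. -/
theorem rayCoord_eq_rayCoord (h : IsTentSlope M lam) (i j : ℤ) {u : ℝ} (hu : gap lam + 1 ≤ u) :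
    rayCoord M lam i u = rayCoord M lam j u := by
  have hl := h.pos
  have hM : (M : ℤ) ≠ 0 := by have := h.two_le; omega
  have base : ∀ (i : ℤ) (u : ℝ), gap lam + 1 ≤ u → u ≤ gap lam + 2 →
      rayCoord M lam i u = u - (gap lam + 1) := by
    intro i u h1 h2
    have hr0 := Int.emod_nonneg (i - 1) hM
    have hr1 := Int.emod_lt_of_pos (i - 1) (show (0 : ℤ) < M by have := h.two_le; omega)
    obtain ⟨r, hr⟩ := Int.eq_ofNat_of_zero_le hr0
    have hi : i ≡ ((r + 1 : ℕ) : ℤ) [ZMOD M] := by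
      have := (Int.mod_modEq (i - 1) M).symm.add_right 1
      rw [hr] at this
      simpa using this
    rw [rayCoord_congr hi, h.rayCoord_rise (by omega) (by omega) _ h2]
    refine le_trans ?_ h1
    rw [← h.pow_mul_gap]
    exact h.pow_le_pow (by omega)
  have step : ∀ (n : ℕ) (i j : ℤ) (u : ℝ), gap lam + 1 ≤ u → u ≤ lam ^ n * (gap lam + 2) →
      rayCoord M lam i u = rayCoord M lam j u := by
    intro n
    induction n with
    | zero =>
      intro i j u h1 h2
      rw [pow_zero, one_mul] at h2
      rw [base i u h1 h2, base j u h1 h2]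
    | succ n ih =>
      intro i j u h1 h2
      rcases le_total u (gap lam + 2) with h3 | h3
      · rw [base i u h1 h3, base j u h1 h3]
      · obtain ⟨v, rfl⟩ : ∃ v, u = lam * v := ⟨u / lam, by field_simp⟩
        rw [pow_succ', mul_assoc] at h2
        rw [← h.mul_gap] at h3
        have hv1 := le_of_mul_le_mul_left h3 hl
        have hv2 := le_of_mul_le_mul_left h2 hl
        have hv0 : 0 ≤ v := by linarith [h.gap_pos]
        rw [← sub_add_cancel i 1, ← sub_add_cancel j 1, h.rayCoord_mul _ hv0,
          h.rayCoord_mul _ hv0, ih (i - 1) (j - 1) v hv1 hv2]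
  obtain ⟨n, hn⟩ := pow_unbounded_of_one_lt u h.one_lt
  refine step n i j u hu (hn.le.trans ?_)
  have := pow_pos hl n
  nlinarith [h.gap_pos]

/-- The ray whose coordinate at level `k` has phase `k + a`, starting at arc length `d + 2`. -/
noncomputable def ray (h : IsTentSlope M lam) (a : ℤ) (s : ℝ≥0) : Orbits lam :=
  ⟨fun k => rayCoord M lam (k + a) (lam ^ k * (gap lam + 2 + s)), by
    have h0 : ∀ k : ℤ, 0 ≤ lam ^ k * (gap lam + 2 + s) := fun k =>
      mul_nonneg (zpow_nonneg h.pos.le k) (by linarith [h.gap_pos, s.2])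
    refine ⟨fun k => abs_le.1 (h.abs_rayCoord_le_one _ (h0 k)), fun k => ?_⟩
    beta_reduce
    rw [← h.rayCoord_mul _ (h0 k), zpow_add_one₀ h.pos.ne']
    congr 1 <;> ring⟩

theorem continuous_ray (h : IsTentSlope M lam) (a : ℤ) : Continuous (h.ray a) := by
  refine Continuous.subtype_mk (continuous_pi fun k => ?_) _
  refine (h.continuousOn_rayCoord (k + a)).comp_continuous (by fun_prop) fun s => ?_
  exact mul_nonneg (zpow_nonneg h.pos.le k) (by linarith [h.gap_pos, s.2])

/-- At a sufficiently negative level of phase `0` the ray has not turned yet. -/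
theorem injective_ray (h : IsTentSlope M lam) (a : ℤ) : Injective (h.ray a) := by
  intro s t hst
  have hs := s.2
  have ht := t.2
  have hd := h.gap_pos
  obtain ⟨n, hn, hun⟩ := h.exists_modEq_le a (gap lam + 2 + s + t)
  have hp := pow_pos h.pos n
  have hna : -(n : ℤ) + a ≡ 0 [ZMOD M] := by
    have := hn.symm.add_left (-(n : ℤ))
    simpa using this
  have h1 := congrFun (congrArg Subtype.val hst) (-(n : ℤ))
  simp only [ray, rayCoord_congr hna, zpow_neg, zpow_natCast] at h1
  have h2 : ∀ r : ℝ, 0 ≤ r → r ≤ lam ^ n * gap lam →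
      rayCoord M lam 0 ((lam ^ n)⁻¹ * r) = 1 - gap lam + (lam ^ n)⁻¹ * r := by
    intro r hr hr2
    refine h.rayCoord_zero_initial (mul_nonneg (inv_nonneg.2 hp.le) hr) ?_
    rwa [inv_mul_le_iff₀ hp]
  rw [h2 _ (by linarith) (by linarith), h2 _ (by linarith) (by linarith)] at h1
  have h3 := mul_left_cancel₀ (inv_ne_zero hp.ne') (add_left_cancel h1)
  exact NNReal.coe_injective (add_left_cancel h3)

theorem eventually_ray_eq (h : IsTentSlope M lam) (a b k : ℤ) :
    ∀ᶠ s in atTop, (h.ray a s).1 k = (h.ray b s).1 k := by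
  have hp := zpow_pos h.pos k
  filter_upwards [eventually_ge_atTop (Real.toNNReal ((gap lam + 1) / lam ^ k))] with s hs
  refine h.rayCoord_eq_rayCoord _ _ ?_
  rw [Real.toNNReal_le_iff_le_coe, div_le_iff₀' hp] at hs
  refine hs.trans (mul_le_mul_of_nonneg_left ?_ hp.le)
  linarith [h.gap_pos]

end IsTentSlope

/-! ### The starting points -/

/-- The letters of `… w w w 1 2^{M-1} 1 2^l`, `w = 1 2^{M-2} 1`, read from right to left. -/
theorem leftPeriodic_cases (M l m : ℕ) (hM : 2 ≤ M) :
    let e := leftPeriodic ([Letter.one] ++ twos (M + 1 - 3) ++ [Letter.one])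
      ([Letter.one] ++ twos (M + 1 - 2) ++ [Letter.one] ++ twos l) m
    (m < l ∧ e = Letter.two) ∨ (m = l ∧ e = Letter.one) ∨
    (l < m ∧ m < l + M ∧ e = Letter.two) ∨ (m = l + M ∧ e = Letter.one) ∨
    ∃ t r, m = l + M + 1 + M * t + r ∧
      ((r = 0 ∧ e = Letter.one) ∨ (1 ≤ r ∧ r + 2 ≤ M ∧ e = Letter.two) ∨
        (r + 1 = M ∧ e = Letter.one)) := by
  intro e
  have hlen : ([Letter.one] ++ twos (M + 1 - 2) ++ [Letter.one] ++ twos l).length = l + M + 1 := by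
    simp [twos]; omega
  have hlen' : ([Letter.one] ++ twos (M + 1 - 3) ++ [Letter.one]).length = M := by
    simp [twos]; omega
  have hv : ([Letter.one] ++ twos (M + 1 - 2) ++ [Letter.one] ++ twos l).reverse =
      twos l ++ Letter.one :: (twos (M - 1) ++ [Letter.one]) := by
    simp [twos]
  have hw : ([Letter.one] ++ twos (M + 1 - 3) ++ [Letter.one]).reverse =
      Letter.one :: (twos (M - 2) ++ [Letter.one]) := by
    simp [twos]
  have he : e = if m < l + M + 1 then
      (twos l ++ Letter.one :: (twos (M - 1) ++ [Letter.one])).getD m Letter.star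
      else (Letter.one :: (twos (M - 2) ++ [Letter.one])).getD ((m - (l + M + 1)) % M)
        Letter.star := by
    simp only [e, leftPeriodic, hlen, hlen', hv, hw]
  clear_value e
  have htwos : ∀ n, (twos n).length = n := fun n => by simp [twos]
  have hget : ∀ n i, i < n → (twos n).getD i Letter.star = Letter.two := fun n i hi => by
    simp [twos, List.getD_eq_getElem?_getD, hi]
  rcases lt_trichotomy m l with h1 | rfl | h1
  · refine Or.inl ⟨h1, ?_⟩
    rw [he, if_pos (by omega), List.getD_append _ _ _ _ (by rwa [htwos]), hget _ _ h1]
  · refine Or.inr (Or.inl ⟨rfl, ?_⟩)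
    rw [he, if_pos (by omega), List.getD_append_right _ _ _ _ (by rw [htwos]), htwos]
    simp
  · obtain ⟨k, rfl⟩ : ∃ k, m = l + (k + 1) := ⟨m - l - 1, by omega⟩
    rcases lt_trichotomy (l + (k + 1)) (l + M) with h2 | h2 | h2
    · refine Or.inr (Or.inr (Or.inl ⟨h1, h2, ?_⟩))
      rw [he, if_pos (by omega), List.getD_append_right _ _ _ _ (by rw [htwos]; omega), htwos,
        Nat.add_sub_cancel_left, List.getD_cons_succ,
        List.getD_append _ _ _ _ (by rw [htwos]; omega), hget _ _ (by omega)]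
    · refine Or.inr (Or.inr (Or.inr (Or.inl ⟨h2, ?_⟩)))
      rw [he, if_pos (by omega), List.getD_append_right _ _ _ _ (by rw [htwos]; omega), htwos,
        Nat.add_sub_cancel_left, List.getD_cons_succ,
        List.getD_append_right _ _ _ _ (by rw [htwos]; omega), htwos,
        show k - (M - 1) = 0 by omega]
      rfl
    · refine Or.inr (Or.inr (Or.inr (Or.inr ?_)))
      rw [if_neg (by omega)] at he
      set q := l + (k + 1) - (l + M + 1) with hq
      have hlt := Nat.mod_lt q (show 0 < M by omega)
      have hdm := Nat.div_add_mod q M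
      generalize q % M = r at he hlt hdm
      refine ⟨q / M, r, by omega, ?_⟩
      rcases r with _ | r
      · exact Or.inl ⟨rfl, by simpa using he⟩
      · rw [List.getD_cons_succ] at he
        rcases Nat.lt_or_ge r (M - 2) with h3 | h3
        · rw [List.getD_append _ _ _ _ (by rwa [htwos]), hget _ _ h3] at he
          exact Or.inr (Or.inl ⟨by omega, by omega, he⟩)
        · rw [List.getD_append_right _ _ _ _ (by rwa [htwos]), htwos,
            show r - (M - 2) = 0 by omega] at he
          exact Or.inr (Or.inr ⟨by omega, he⟩)

namespace IsTentSlope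

variable {M : ℕ} {lam : ℝ}

theorem div_pow_le (h : IsTentSlope M lam) {m j : ℕ} (hmj : M ≤ j + m) :
    (gap lam + 1) / lam ^ m ≤ lam ^ j * gap lam := by
  have hp := pow_pos h.pos m
  rw [div_le_iff₀ hp, ← h.pow_mul_gap]
  have := h.pow_le_pow hmj
  rw [pow_add] at this
  linarith

theorem le_div_pow (h : IsTentSlope M lam) {m j : ℕ} (hmj : j + m ≤ M) :
    lam ^ j * gap lam ≤ (gap lam + 1) / lam ^ m := by
  have hp := pow_pos h.pos m
  rw [le_div_iff₀ hp, ← h.pow_mul_gap]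
  have := h.pow_le_pow hmj
  rw [pow_add] at this
  linarith

/-- The starting point of the ray of phase `1 + l` lies in `T(… w w w 1 2^{M-1} 1 2^l)`. -/
theorem side_rayCoord_compat (h : IsTentSlope M lam) {l : ℕ} (hl : l < M) (m : ℕ) :
    (side (rayCoord M lam ((l : ℤ) - m) ((gap lam + 1) / lam ^ m))).Compat
      (leftPeriodic ([Letter.one] ++ twos (M + 1 - 3) ++ [Letter.one])
        ([Letter.one] ++ twos (M + 1 - 2) ++ [Letter.one] ++ twos l) m) := by
  have hM := h.two_le
  have hlam := h.pos
  have hd := h.gap_pos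
  have hp := pow_pos hlam m
  have hu : 0 ≤ (gap lam + 1) / lam ^ m := div_nonneg (by linarith) hp.le
  have hu1 : (gap lam + 1) / lam ^ m ≤ gap lam + 1 :=
    div_le_self (by linarith) (one_le_pow₀ h.one_lt.le)
  have congr : ∀ (j : ℕ) (c : ℤ), (l : ℤ) - m = j + M * c →
      rayCoord M lam ((l : ℤ) - m) ((gap lam + 1) / lam ^ m) =
        rayCoord M lam (j : ℤ) ((gap lam + 1) / lam ^ m) := fun j c hc =>
    rayCoord_congr (by rw [hc]; simp [Int.ModEq]) _
  -- before the first turn, all phases except `0` and `M - 1` stay on the left of the critical point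
  have initial : ∀ j : ℕ, 1 ≤ j → j + 2 ≤ M → M ≤ j + m →
      rayCoord M lam (j : ℤ) ((gap lam + 1) / lam ^ m) ≤ 0 := fun j h1 h2 h3 => by
    rw [h.rayCoord_initial h1 (by omega) hu (h.div_pow_le h3)]
    linarith [h.two_mul_pow_le h2]
  -- phase `M - 1` crosses the critical point at arc length `d / λ`
  have last : M ≤ M - 1 + m → rayCoord M lam ((M - 1 : ℕ) : ℤ) ((gap lam + 1) / lam ^ m) =
      (gap lam - lam * ((gap lam + 1) / lam ^ m)) / lam := fun h1 => by
    rw [h.rayCoord_initial (by omega) (by omega) hu (h.div_pow_le h1), eq_div_iff hlam.ne']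
    have h2 := h.pow_mul_gap
    have h3 : lam ^ M = lam ^ (M - 1) * lam := by rw [← pow_succ]; congr 1; omega
    rw [h3] at h2
    linarith [h.mul_gap]
  have hmul : ∀ k, m = k + 1 → lam * ((gap lam + 1) / lam ^ m) = (gap lam + 1) / lam ^ k := by
    rintro k rfl
    rw [pow_succ]; field_simp
  rcases leftPeriodic_cases M l m hM with ⟨h1, he⟩ | ⟨h1, he⟩ | ⟨h1, h2, he⟩ | ⟨h1, he⟩ |
    ⟨t, r, h1, ⟨h2, he⟩ | ⟨h2, h3, he⟩ | ⟨h2, he⟩⟩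
  all_goals rw [he]
  · refine side_compat_two ?_
    rw [congr (l - m) 0 (by omega), h.rayCoord_rise (by omega) (by omega)
      (h.le_div_pow (by omega)) (by linarith)]
    linarith
  · refine side_compat_one ?_
    rw [congr 0 0 (by omega), Nat.cast_zero, h.rayCoord_zero_turn _ hu1]
    · linarith
    · simpa using h.le_div_pow (m := m) (j := 0) (by omega)
  · refine side_compat_two ?_
    obtain ⟨k, rfl⟩ : ∃ k, m = l + 1 + k := ⟨m - l - 1, by omega⟩
    rw [congr (M - 1 - k) (-1) (by omega)]
    rcases Nat.eq_zero_or_pos k with rfl | hk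
    · rw [Nat.sub_zero, last (by omega), hmul l rfl]
      refine div_nonpos_of_nonpos_of_nonneg ?_ hlam.le
      have := h.le_div_pow (m := l) (j := 0) (by omega)
      rw [pow_zero, one_mul] at this
      linarith
    · exact initial _ (by omega) (by omega) (by omega)
  · refine side_compat_one ?_
    have hle := h.div_pow_le (m := m) (j := 0) (by omega)
    rw [pow_zero, one_mul] at hle
    rw [congr 0 (-1) (by omega), Nat.cast_zero, h.rayCoord_zero_initial hu hle]
    linarith [h.gap_le_one]
  · refine side_compat_one ?_
    have hm := hmul (l + M + M * t) (by omega)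
    have hc : (l : ℤ) - m = ((M - 1 : ℕ) : ℤ) + M * (-2 - t) := by
      rw [h1, h2, Nat.cast_sub (by omega)]
      push_cast; ring
    rw [congr _ _ hc, last (by omega), hm]
    refine div_nonneg ?_ hlam.le
    have := h.div_pow_le (m := l + M + M * t) (j := 0) (by omega)
    rw [pow_zero, one_mul] at this
    linarith
  · refine side_compat_two ?_
    have hc : (l : ℤ) - m = ((M - 1 - r : ℕ) : ℤ) + M * (-2 - t) := by
      rw [Nat.sub_sub, Nat.cast_sub (by omega), h1]
      push_cast; ring
    rw [congr _ _ hc]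
    exact initial _ (by omega) (by omega) (by omega)
  · refine side_compat_one ?_
    have hc : (l : ℤ) - m = ((0 : ℕ) : ℤ) + M * (-2 - t) := by
      have : (r : ℤ) = M - 1 := by omega
      rw [h1]
      push_cast
      rw [this]; ring
    have hle := h.div_pow_le (m := m) (j := 0) (by omega)
    rw [pow_zero, one_mul] at hle
    rw [congr _ _ hc, Nat.cast_zero, h.rayCoord_zero_initial hu hle]
    linarith [h.gap_le_one]

theorem coding_ray_zero_mem_T (h : IsTentSlope M lam) {l : ℕ} (hl : l < M) :
    coding h.one_lt h.lt_two.le h.side_iterate_zero (h.ray (1 + l) 0) ∈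
      T (kneading (M + 1)) (leftPeriodic ([Letter.one] ++ twos (M + 1 - 3) ++ [Letter.one])
        ([Letter.one] ++ twos (M + 1 - 2) ++ [Letter.one] ++ twos l)) := by
  intro m
  have h1 := h.side_rayCoord_compat hl m
  have h2 : lam ^ (-((m : ℤ) + 1)) * (gap lam + 2 + ((0 : ℝ≥0) : ℝ)) =
      (gap lam + 1) / lam ^ m := by
    have hl := h.pos
    have hp := pow_pos hl m
    rw [NNReal.coe_zero, add_zero, ← h.mul_gap, zpow_neg, zpow_add_one₀ hl.ne', zpow_natCast]
    field_simp
  have h3 : -((m : ℤ) + 1) + (1 + l) = l - m := by ring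
  rw [← h2, ← h3] at h1
  exact h1

end IsTentSlope
end DendriteLimit

theorem mainTheorem1 (N l : ℕ) (hl : 1 ≤ l) (hlN : l ≤ N - 2) :
    ∃ φ φ' : ℝ≥0 → DendriteLimit.DHat (DendriteLimit.kneading N),
      DendriteLimit.ParametrizesRay φ ∧
      DendriteLimit.ParametrizesRay φ' ∧
      φ 0 ∈ DendriteLimit.T (DendriteLimit.kneading N) (DendriteLimit.eSeq N) ∧
      φ' 0 ∈ DendriteLimit.T (DendriteLimit.kneading N) (DendriteLimit.eTildeSeq N l) ∧
      DendriteLimit.Asymptotic φ φ' := by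
  open DendriteLimit in
  obtain ⟨M, rfl⟩ : ∃ M, N = M + 1 := ⟨N - 1, by omega⟩
  obtain ⟨lam, h⟩ := exists_isTentSlope (show 2 ≤ M by omega)
  have hτ := h.side_iterate_zero
  have hcont := continuous_coding h.one_lt h.lt_two.le hτ
  have hinj := injective_coding h.one_lt h.lt_two.le hτ
  refine ⟨fun s => coding h.one_lt h.lt_two.le hτ (h.ray (1 + (0 : ℕ)) s),
    fun s => coding h.one_lt h.lt_two.le hτ (h.ray (1 + l) s),
    ⟨hcont.comp (h.continuous_ray _), hinj.comp (h.injective_ray _)⟩,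
    ⟨hcont.comp (h.continuous_ray _), hinj.comp (h.injective_ray _)⟩,
    ?_, h.coding_ray_zero_mem_T (by omega), asymptotic_coding _ _ _ _ _ (h.eventually_ray_eq _ _)⟩
  have h0 := h.coding_ray_zero_mem_T (l := 0) (by omega)
  rwa [show twos 0 = [] from rfl, List.append_nil] at h0
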